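/- Let $q\in\mathbb{C}\setminus\{0\}$ satisfy $q^n\neq 1$ for all non-zero integers $n$. Let $\mathbb{C}_q[x^{\pm1},y^{\pm1}]$ be the unital $\mathbb{C}$-algebra generated by $x,x^{-1},y,y^{-1}$ with relations $yx=qxy$, $xx^{-1}=x^{-1}x=yy^{-1}=y^{-1}y=1$. Let $U_q(\mathfrak{sl}_2)$ be the unital $\mathbb{C}$-algebra generated by $\mathsf k,\mathsf k^{-1},\mathsf e,\mathsf f$ with relations $\mathsf k\mathsf k^{-1}=\mathsf k^{-1}\mathsf k=1$, $\mathsf k\mathsf e=q^2\mathsf e\mathsf k$, $\mathsf k\mathsf f=q^{-2}\mathsf f\mathsf k$, $\mathsf e\mathsf f-\mathsf f\mathsf e=\frac{\mathsf k-\mathsf k^{-1}}{q-q^{-1}}$, with comultiplication $\Delta(\mathsf k)=\mathsf k\otimes\mathsf k$, $\Delta(\mathsf e)=1\otimes\mathsf e+\mathsf e\otimes\mathsf k$, $\Delta(\mathsf f)=\mathsf f\otimes 1+\mathsf k^{-1}\otimes\mathsf f$ and counit $\varepsilon(\mathsf k)=1$, $\varepsilon(\mathsf e)=\varepsilon(\mathsf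 f)=0$. A *symmetry* is a structure of $U_q(\mathfrak{sl}_2)$-module algebra on $A=\mathbb{C}_q[x^{\pm1},y^{\pm1}]$, i.e. an algebra homomorphism $\pi:U_q(\mathfrak{sl}_2)\to\operatorname{End}_{\mathbb C}A$ with $\pi(h)(ab)=\sum\pi(h')(a)\,\pi(h'')(b)$, where $\Delta(h)=\sum h'\otimes h''$, and $\pi(h)(1)=\varepsilon(h)1$. The group $\operatorname{Aut}(A)$ of algebra automorphisms acts on symmetries by $(\Psi\cdot\pi)(h)=\Psi\pi(h)\Psi^{-1}$, and two symmetries are isomorphic if they lie in the same orbit. Call a pair $(\alpha,\beta)\in(\mathbb{C}\setminus\{0\})^2$ *admissible* if $\alpha^u\beta^v=q^2$ for some $u,v\in\mathbb{Z}$, while $\alpha^m\neq\beta^n$ for all integers $(m,n)\neq(0,0)$. A symmetry $\pi$ is *generic with weight constants $(\alpha,\beta)$* if $(\alpha,\beta)$ is admissible and, for some $u,v\in\mathbb{Z}$ with $\alpha^u\beta^v=q^2$ and some $a\in\mathbb{C}\setminus\{0\}$, $$\pi(\mathsf k)(x)=\alpha x,\qquad \pi(\mathsf k)(y)=\beta y,$$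 $$\pi(\mathsf e)(x)=aq^{uv+3}\frac{1-\alpha q^v}{(1-q^2)^2}x^{u+1}y^v,\qquad \pi(\mathsf e)(y)=aq^{uv+3}\frac{q^u-\beta}{(1-q^2)^2}x^uy^{v+1},$$ $$\pi(\mathsf f)(x)=-\frac{\alpha^{-1}-q^{-v}}{a}x^{-u+1}y^{-v},\qquad \pi(\mathsf f)(y)=-\frac{\beta^{-1}q^{-u}-1}{a}x^{-u}y^{-v+1}.$$ Then: 1. for every admissible $(\alpha,\beta)$, all $u,v\in\mathbb{Z}$ with $\alpha^u\beta^v=q^2$ and every $a\in\mathbb{C}\setminus\{0\}$, there is exactly one symmetry given by these formulas; 2. the set of admissible pairs $(\alpha,\beta)$ is uncountable; 3. for every generic symmetry $\pi$, the set of admissible pairs $(\alpha,\beta)$ that are the weight constants of some generic symmetry in the $\operatorname{Aut}(A)$-orbit of $\pi$ is countable; 4. the generic symmetries fall into uncountably many isomorphism classes. -/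

import Mathlib

open scoped TensorProduct

/-! ### Module algebra structures over a bialgebra -/

/-- A structure of `H`-module algebra on a unital algebra `A`: an algebra homomorphism
`π : H → End A` with `π(h)(ab) = ∑ π(h')(a) π(h'')(b)`, where `Δ(h) = ∑ h' ⊗ h''`,
and `π(h)(1) = ε(h) 1`. -/
@[ext]
structure ModuleAlgebraStructure (R H A : Type*) [CommRing R] [Ring H] [Bialgebra R H]
    [Ring A] [Algebra R A] where
  /-- The action of `H` on `A` by linear endomorphisms. -/
  act : H →ₐ[R] Module.End R A
  act_mul : ∀ (h : H) (a b : A),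
    act h (a * b) = LinearMap.mul' R A
      (TensorProduct.map (act.toLinearMap.flip a) (act.toLinearMap.flip b)
        (Coalgebra.comul (R := R) h))
  act_one : ∀ h : H, act h 1 = algebraMap R A (Coalgebra.counit (R := R) h)

namespace ModuleAlgebraStructure

variable {R H A : Type*} [CommRing R] [Ring H] [Bialgebra R H] [Ring A] [Algebra R A]

/-- Two structures are isomorphic if `Ψ π₁(h) Ψ⁻¹ = π₂(h)` for all `h`, for some algebra
automorphism `Ψ` of `A`. -/
def Isomorphic (π₁ π₂ : ModuleAlgebraStructure R H A) : Prop :=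
  ∃ Ψ : A ≃ₐ[R] A, ∀ (h : H) (a : A), Ψ (π₁.act h (Ψ.symm a)) = π₂.act h a

/-- Isomorphism is an equivalence relation. -/
instance isoSetoid : Setoid (ModuleAlgebraStructure R H A) where
  r := Isomorphic
  iseqv :=
    { refl := fun _ => ⟨AlgEquiv.refl, fun _ _ => rfl⟩
      symm := by
        rintro π₁ π₂ ⟨Ψ, hΨ⟩
        refine ⟨Ψ.symm, fun h a => ?_⟩
        rw [← hΨ]
        simp
      trans := by
        rintro π₁ π₂ π₃ ⟨Ψ, hΨ⟩ ⟨Φ, hΦ⟩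
        refine ⟨Ψ.trans Φ, fun h a => ?_⟩
        rw [← hΦ, ← hΨ]
        rfl }

/-- The set of isomorphism classes of `H`-module algebra structures on `A`. -/
def IsoClass (R H A : Type*) [CommRing R] [Ring H] [Bialgebra R H] [Ring A] [Algebra R A] :
    Type _ :=
  Quotient (isoSetoid (R := R) (H := H) (A := A))

/-- The isomorphism class of a structure. -/
def isoClass (π : ModuleAlgebraStructure R H A) : IsoClass R H A :=
  Quotient.mk _ π

/-- The structure `h ↦ Ψ π(h) Ψ⁻¹`. -/
def conj (Ψ : A ≃ₐ[R] A) (π : ModuleAlgebraStructure R H A) : ModuleAlgebraStructure R H A where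
  act := (Ψ.toLinearEquiv.conjAlgEquiv R).toAlgHom.comp π.act
  act_mul h a b := by
    have key : ∀ t : H ⊗[R] H,
        Ψ (LinearMap.mul' R A (TensorProduct.map (π.act.toLinearMap.flip (Ψ.symm a))
          (π.act.toLinearMap.flip (Ψ.symm b)) t)) =
        LinearMap.mul' R A (TensorProduct.map
          (((Ψ.toLinearEquiv.conjAlgEquiv R).toAlgHom.comp π.act).toLinearMap.flip a)
          (((Ψ.toLinearEquiv.conjAlgEquiv R).toAlgHom.comp π.act).toLinearMap.flip b) t) := by
      intro t
      induction t with
      | zero => simp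
      | tmul x y => simp [LinearEquiv.conjAlgEquiv]
      | add x y hx hy => simp only [map_add, hx, hy]
    rw [← key, ← π.act_mul, ← map_mul]
    rfl
  act_one h := by
    have : Ψ (π.act h (Ψ.symm 1)) = algebraMap R A (Coalgebra.counit (R := R) h) := by
      rw [map_one, π.act_one, AlgEquiv.commutes]
    exact this

/-- The automorphism group of `A` acts on the set of `H`-module algebra structures on `A`
by conjugation. -/
instance : MulAction (A ≃ₐ[R] A) (ModuleAlgebraStructure R H A) where
  smul := conj
  one_smul _ := rfl
  mul_smul _ _ _ := rfl

end ModuleAlgebraStructure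

/-! ### The quantum universal enveloping algebra of `sl₂` -/

namespace Uqsl2

/-- The Chevalley generators. -/
inductive Gen : Type
  | k | kinv | e | f

/-- The generators as elements of the free algebra. -/
def g (s : Gen) : FreeAlgebra ℂ Gen := FreeAlgebra.ι ℂ s

/-- The defining relations. -/
inductive Rel (q : ℂˣ) : FreeAlgebra ℂ Gen → FreeAlgebra ℂ Gen → Prop
  | kinv_k : Rel q (g .kinv * g .k) 1
  | k_kinv : Rel q (g .k * g .kinv) 1
  | k_e : Rel q (g .k * g .e) ((q : ℂ) ^ (2 : ℤ) • (g .e * g .k))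
  | k_f : Rel q (g .k * g .f) ((q : ℂ) ^ (-2 : ℤ) • (g .f * g .k))
  | e_f : Rel q (g .e * g .f - g .f * g .e)
      (((q : ℂ) - (q : ℂ)⁻¹)⁻¹ • (g .k - g .kinv))

end Uqsl2

/-- The algebra `U_q(sl₂)`, by generators and relations. -/
def Uqsl2 (q : ℂˣ) : Type := RingQuot (Uqsl2.Rel q)

namespace Uqsl2

noncomputable section

variable (q : ℂˣ)

instance : Ring (Uqsl2 q) := inferInstanceAs (Ring (RingQuot (Rel q)))
instance instAlg : Algebra ℂ (Uqsl2 q) := inferInstanceAs (Algebra ℂ (RingQuot (Rel q)))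

/-- The canonical projection from the free algebra. -/
def mk : FreeAlgebra ℂ Gen →ₐ[ℂ] Uqsl2 q := RingQuot.mkAlgHom ℂ (Rel q)

/-- The generator `k`. -/
def k : Uqsl2 q := mk q (g .k)
/-- The generator `k⁻¹`. -/
def kinv : Uqsl2 q := mk q (g .kinv)
/-- The generator `e`. -/
def e : Uqsl2 q := mk q (g .e)
/-- The generator `f`. -/
def f : Uqsl2 q := mk q (g .f)

theorem mk_rel {a b : FreeAlgebra ℂ Gen} (h : Rel q a b) : mk q a = mk q b :=
  RingQuot.mkAlgHom_rel ℂ h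

theorem kinv_mul_k : kinv q * k q = 1 := by
  simpa [k, kinv] using mk_rel q Rel.kinv_k

theorem k_mul_kinv : k q * kinv q = 1 := by
  simpa [k, kinv] using mk_rel q Rel.k_kinv

theorem k_mul_e : k q * e q = (q : ℂ) ^ (2 : ℤ) • (e q * k q) := by
  simpa only [map_mul, map_smul, k, e] using mk_rel q Rel.k_e

theorem k_mul_f : k q * f q = (q : ℂ) ^ (-2 : ℤ) • (f q * k q) := by
  simpa only [map_mul, map_smul, k, f] using mk_rel q Rel.k_f

theorem e_mul_f : e q * f q - f q * e q = ((q : ℂ) - (q : ℂ)⁻¹)⁻¹ • (k q - kinv q) := by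
  simpa only [map_mul, map_smul, map_sub, k, kinv, e, f] using mk_rel q Rel.e_f

theorem kinv_mul_e : kinv q * e q = (q : ℂ) ^ (-2 : ℤ) • (e q * kinv q) := by
  have hq : (q : ℂ) ≠ 0 := q.ne_zero
  have h : kinv q * (k q * e q) * kinv q = (q : ℂ) ^ (2 : ℤ) • (kinv q * e q) := by
    rw [k_mul_e, mul_smul_comm, smul_mul_assoc, mul_assoc, mul_assoc, k_mul_kinv, mul_one]
  rw [← mul_assoc, kinv_mul_k, one_mul] at h
  rw [h, smul_smul, ← zpow_add₀ hq]
  simp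

theorem f_mul_k : f q * k q = (q : ℂ) ^ (2 : ℤ) • (k q * f q) := by
  have hq : (q : ℂ) ≠ 0 := q.ne_zero
  rw [k_mul_f, smul_smul, ← zpow_add₀ hq]
  simp

variable {q}

/-- The universal property of `U_q(sl₂)`. -/
def lift {B : Type*} [Ring B] [Algebra ℂ B] (K K' E F : B)
    (h1 : K' * K = 1) (h2 : K * K' = 1)
    (h3 : K * E = (q : ℂ) ^ (2 : ℤ) • (E * K))
    (h4 : K * F = (q : ℂ) ^ (-2 : ℤ) • (F * K))
    (h5 : E * F - F * E = ((q : ℂ) - (q : ℂ)⁻¹)⁻¹ • (K - K')) : Uqsl2 q →ₐ[ℂ] B :=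
  RingQuot.liftAlgHom ℂ ⟨FreeAlgebra.lift ℂ (fun s => Gen.casesOn s K K' E F), by
    rintro _ _ (_ | _ | _ | _ | _) <;> simp only [g, map_mul, map_smul, map_sub, map_one,
      FreeAlgebra.lift_ι_apply] <;> assumption⟩

section liftLemmas

variable {B : Type*} [Ring B] [Algebra ℂ B] {K K' E F : B}
    {h1 : K' * K = 1} {h2 : K * K' = 1}
    {h3 : K * E = (q : ℂ) ^ (2 : ℤ) • (E * K)}
    {h4 : K * F = (q : ℂ) ^ (-2 : ℤ) • (F * K)}
    {h5 : E * F - F * E = ((q : ℂ) - (q : ℂ)⁻¹)⁻¹ • (K - K')}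

theorem lift_g (s : Gen) :
    lift K K' E F h1 h2 h3 h4 h5 (mk q (g s)) = Gen.casesOn s K K' E F := by
  unfold lift mk
  exact (RingQuot.liftAlgHom_mkAlgHom_apply _ _ _ _).trans (FreeAlgebra.lift_ι_apply _ _)

@[simp] theorem lift_k : lift K K' E F h1 h2 h3 h4 h5 (k q) = K := lift_g .k
@[simp] theorem lift_kinv : lift K K' E F h1 h2 h3 h4 h5 (kinv q) = K' := lift_g .kinv
@[simp] theorem lift_e : lift K K' E F h1 h2 h3 h4 h5 (e q) = E := lift_g .e
@[simp] theorem lift_f : lift K K' E F h1 h2 h3 h4 h5 (f q) = F := lift_g .f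

end liftLemmas

theorem algHom_ext {B : Type*} [Ring B] [Algebra ℂ B] {φ ψ : Uqsl2 q →ₐ[ℂ] B}
    (hk : φ (k q) = ψ (k q)) (hk' : φ (kinv q) = ψ (kinv q))
    (he : φ (e q) = ψ (e q)) (hf : φ (f q) = ψ (f q)) : φ = ψ := by
  apply RingQuot.ringQuot_ext' (S := ℂ)
  apply FreeAlgebra.hom_ext
  funext s
  cases s
  · exact hk
  · exact hk'
  · exact he
  · exact hf

variable (q)

/-- The comultiplication: `Δ(k) = k ⊗ k`, `Δ(e) = 1 ⊗ e + e ⊗ k`, `Δ(f) = f ⊗ 1 + k⁻¹ ⊗ f`. -/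
def comulHom : Uqsl2 q →ₐ[ℂ] Uqsl2 q ⊗[ℂ] Uqsl2 q :=
  lift (k q ⊗ₜ k q) (kinv q ⊗ₜ kinv q) (1 ⊗ₜ e q + e q ⊗ₜ k q) (f q ⊗ₜ 1 + kinv q ⊗ₜ f q)
    (by simp [kinv_mul_k, Algebra.TensorProduct.one_def])
    (by simp [k_mul_kinv, Algebra.TensorProduct.one_def])
    (by
      simp only [mul_add, add_mul, Algebra.TensorProduct.tmul_mul_tmul, mul_one, one_mul,
        k_mul_e, smul_add, TensorProduct.tmul_smul, TensorProduct.smul_tmul'])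
    (by
      simp only [mul_add, add_mul, Algebra.TensorProduct.tmul_mul_tmul, mul_one, one_mul,
        k_mul_f, smul_add, TensorProduct.tmul_smul, TensorProduct.smul_tmul', k_mul_kinv,
        kinv_mul_k])
    (by
      have hq : (q : ℂ) ≠ 0 := q.ne_zero
      have cross : (kinv q * e q) ⊗ₜ[ℂ] (f q * k q) = (e q * kinv q) ⊗ₜ[ℂ] (k q * f q) := by
        rw [kinv_mul_e, f_mul_k, TensorProduct.tmul_smul, ← TensorProduct.smul_tmul', smul_smul,
          ← zpow_add₀ hq]
        simp
      have h1 : e q * f q = f q * e q + ((q : ℂ) - (q : ℂ)⁻¹)⁻¹ • (k q - kinv q) := by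
        rw [← e_mul_f]; abel
      simp only [mul_add, add_mul, Algebra.TensorProduct.tmul_mul_tmul, mul_one, one_mul, cross,
        h1, TensorProduct.tmul_add, TensorProduct.add_tmul, TensorProduct.tmul_smul,
        ← TensorProduct.smul_tmul', TensorProduct.tmul_sub, TensorProduct.sub_tmul, smul_sub]
      abel)

/-- The counit: `ε(k) = 1`, `ε(e) = ε(f) = 0`. -/
def counitHom : Uqsl2 q →ₐ[ℂ] ℂ :=
  lift 1 1 0 0 (by simp) (by simp) (by simp) (by simp) (by simp)

instance : Bialgebra ℂ (Uqsl2 q) :=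
  Bialgebra.ofAlgHom (comulHom q) (counitHom q)
    (by
      apply algHom_ext <;>
        simp [comulHom, TensorProduct.add_tmul, TensorProduct.tmul_add,
          Algebra.TensorProduct.one_def, add_assoc])
    (by apply algHom_ext <;> simp [comulHom, counitHom])
    (by apply algHom_ext <;> simp [comulHom, counitHom])

end

end Uqsl2

/-! ### The Laurent polynomial algebra over the quantum plane -/

namespace QLaurent

/-- The generators `x, y, x⁻¹, y⁻¹`. -/
inductive Gen : Type
  | x | y | xinv | yinv

/-- The generators as elements of the free algebra. -/
def g (s : Gen) : FreeAlgebra ℂ Gen := FreeAlgebra.ι ℂ s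

/-- The defining relations: `yx = qxy`, `x x⁻¹ = x⁻¹ x = y y⁻¹ = y⁻¹ y = 1`. -/
inductive Rel (q : ℂˣ) : FreeAlgebra ℂ Gen → FreeAlgebra ℂ Gen → Prop
  | y_x : Rel q (g .y * g .x) ((q : ℂ) • (g .x * g .y))
  | x_xinv : Rel q (g .x * g .xinv) 1
  | xinv_x : Rel q (g .xinv * g .x) 1
  | y_yinv : Rel q (g .y * g .yinv) 1
  | yinv_y : Rel q (g .yinv * g .y) 1

end QLaurent

/-- The algebra `ℂ_q[x^{±1}, y^{±1}]`, by generators and relations. -/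
def QLaurent (q : ℂˣ) : Type := RingQuot (QLaurent.Rel q)

namespace QLaurent

noncomputable section

variable (q : ℂˣ)

instance : Ring (QLaurent q) := inferInstanceAs (Ring (RingQuot (Rel q)))
instance : Algebra ℂ (QLaurent q) := inferInstanceAs (Algebra ℂ (RingQuot (Rel q)))

/-- The canonical projection from the free algebra. -/
def mk : FreeAlgebra ℂ Gen →ₐ[ℂ] QLaurent q := RingQuot.mkAlgHom ℂ (Rel q)

theorem mk_rel {a b : FreeAlgebra ℂ Gen} (h : Rel q a b) : mk q a = mk q b :=
  RingQuot.mkAlgHom_rel ℂ h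

/-- The generator `x`, as an invertible element. -/
def x : (QLaurent q)ˣ where
  val := mk q (g .x)
  inv := mk q (g .xinv)
  val_inv := by simpa using mk_rel q Rel.x_xinv
  inv_val := by simpa using mk_rel q Rel.xinv_x

/-- The generator `y`, as an invertible element. -/
def y : (QLaurent q)ˣ where
  val := mk q (g .y)
  inv := mk q (g .yinv)
  val_inv := by simpa using mk_rel q Rel.y_yinv
  inv_val := by simpa using mk_rel q Rel.yinv_y

/-- The monomial `x^i y^j`, for integers `i` and `j`. -/
def mon (i j : ℤ) : QLaurent q := ((x q ^ i * y q ^ j : (QLaurent q)ˣ) : QLaurent q)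

end

end QLaurent

/-! ### Generic symmetries -/

/-- A symmetry: a structure of `U_q(sl₂)`-module algebra on `ℂ_q[x^{±1}, y^{±1}]`. -/
abbrev QSymmetry (q : ℂˣ) : Type := ModuleAlgebraStructure ℂ (Uqsl2 q) (QLaurent q)

/-- A pair of weight constants is admissible if `α^u β^v = q²` for some integers `u, v`, while
`α^m ≠ β^n` for all integers `m, n` which are not both zero. -/
def IsAdmissible (q α β : ℂˣ) : Prop :=
  (∃ u v : ℤ, α ^ u * β ^ v = q ^ 2) ∧ ∀ m n : ℤ, (m, n) ≠ (0, 0) → α ^ m ≠ β ^ n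

/-- The explicit formulas for the generic symmetry with weight constants `α, β`, exponents `u, v`
and parameter `a`. -/
structure HasGenericFormulas (q α β : ℂˣ) (u v : ℤ) (a : ℂˣ) (π : QSymmetry q) : Prop where
  k_x : π.act (Uqsl2.k q) (QLaurent.x q : QLaurent q) = (α : ℂ) • (QLaurent.x q : QLaurent q)
  k_y : π.act (Uqsl2.k q) (QLaurent.y q : QLaurent q) = (β : ℂ) • (QLaurent.y q : QLaurent q)
  e_x : π.act (Uqsl2.e q) (QLaurent.x q : QLaurent q) =
    ((a : ℂ) * (q : ℂ) ^ (u * v + 3) * ((1 - (α : ℂ) * (q : ℂ) ^ v) / (1 - (q : ℂ) ^ 2) ^ 2)) •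
      QLaurent.mon q (u + 1) v
  e_y : π.act (Uqsl2.e q) (QLaurent.y q : QLaurent q) =
    ((a : ℂ) * (q : ℂ) ^ (u * v + 3) * (((q : ℂ) ^ u - (β : ℂ)) / (1 - (q : ℂ) ^ 2) ^ 2)) •
      QLaurent.mon q u (v + 1)
  f_x : π.act (Uqsl2.f q) (QLaurent.x q : QLaurent q) =
    (-(((α : ℂ)⁻¹ - (q : ℂ) ^ (-v)) / (a : ℂ))) • QLaurent.mon q (-u + 1) (-v)
  f_y : π.act (Uqsl2.f q) (QLaurent.y q : QLaurent q) =
    (-(((β : ℂ)⁻¹ * (q : ℂ) ^ (-u) - 1) / (a : ℂ))) • QLaurent.mon q (-u) (-v + 1)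

/-- `π` is a generic symmetry with (admissible) weight constants `α, β`. -/
def IsGenericWithWeights (q α β : ℂˣ) (π : QSymmetry q) : Prop :=
  IsAdmissible q α β ∧
    ∃ (u v : ℤ) (a : ℂˣ), α ^ u * β ^ v = q ^ 2 ∧ HasGenericFormulas q α β u v a π

/-- `π` is a generic symmetry. -/
def IsGeneric (q : ℂˣ) (π : QSymmetry q) : Prop :=
  ∃ α β : ℂˣ, IsGenericWithWeights q α β π

/-! Existence rests on inner skew derivations. If `m = x^u y^v` and `K` is the diagonal automorphism
with weights `α, β`, then `α^u β^v = q²` says `K m = q² m`. Hence `E b = c (b m - m K b)` and `F b =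
d (n b - K⁻¹(b) n)`, with `n = x^{-u} y^{-v}`, have the right weights and satisfy the Leibniz rules.
In `EF - FE` the mixed terms `n b m` and `m b n` cancel, leaving a multiple of `K - K⁻¹` that is
correct for exactly one value of `c d`; the free ratio is the parameter `a` (`exists_inner`).
Uniqueness holds because a skew derivation is determined by its values on `x` and `y`
(`skewDerivation_ext`).

The isomorphism invariant is the spectrum of `k`. It is diagonal on monomials, so its eigenvalues
lie in the countable group generated by `α` and `β`. Conjugation preserves the spectrum, and the
weights of any generic symmetry in the orbit are eigenvalues, with eigenvectors `x` and `y`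
(`countable_weights`). Admissible pairs are uncountable: fix `α = q²` and avoid countably many `β`
(`not_countable_isAdmissible`). Countably many isomorphism classes would then cover an uncountable
set by countably many countable ones. -/

/-! ### Module algebra structures: reduction to generators -/

namespace ModuleAlgebraStructure

variable {R H A : Type*} [CommRing R] [Ring H] [Bialgebra R H] [Ring A] [Algebra R A]

/-- The compatibility of an action with the multiplication at a single element `h`. -/
def ActMulAt (act : H →ₐ[R] Module.End R A) (h : H) : Prop :=
  ∀ a b : A, act h (a * b) = LinearMap.mul' R A
    (TensorProduct.map (act.toLinearMap.flip a) (act.toLinearMap.flip b)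
      (Coalgebra.comul (R := R) h))

theorem ActMulAt.algebraMap (act : H →ₐ[R] Module.End R A) (r : R) :
    ActMulAt act (algebraMap R H r) := by
  intro a b
  rw [Bialgebra.comul_algebraMap, Algebra.TensorProduct.algebraMap_apply]
  simp [Algebra.algebraMap_eq_smul_one]

theorem ActMulAt.add {act : H →ₐ[R] Module.End R A} {h₁ h₂ : H}
    (h : ActMulAt act h₁) (h' : ActMulAt act h₂) : ActMulAt act (h₁ + h₂) := by
  intro a b
  rw [map_add, map_add, LinearMap.add_apply, h, h', map_add, map_add]

/-- Multiplicativity of the comultiplication is what makes this work: together with linearity and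
the cases of `0` and `1`, it reduces compatibility with products to algebra generators of `H`. -/
theorem ActMulAt.mul {act : H →ₐ[R] Module.End R A} {h₁ h₂ : H}
    (h : ActMulAt act h₁) (h' : ActMulAt act h₂) : ActMulAt act (h₁ * h₂) := by
  intro a b
  -- Acting first by `c` and `d` on the arguments amounts to right multiplication of the tensor by
  -- `c ⊗ d`.
  have inner : ∀ (s : H ⊗[R] H) (c d : H),
      LinearMap.mul' R A (TensorProduct.map (act.toLinearMap.flip (act c a))
        (act.toLinearMap.flip (act d b)) s) =
      LinearMap.mul' R A (TensorProduct.map (act.toLinearMap.flip a)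
        (act.toLinearMap.flip b) (s * c ⊗ₜ d)) := by
    intro s c d
    induction s with
    | zero => simp
    | tmul x y => simp
    | add x y hx hy => simp only [add_mul, map_add, hx, hy]
  have outer : ∀ t : H ⊗[R] H,
      act h₁ (LinearMap.mul' R A (TensorProduct.map (act.toLinearMap.flip a)
        (act.toLinearMap.flip b) t)) =
      LinearMap.mul' R A (TensorProduct.map (act.toLinearMap.flip a)
        (act.toLinearMap.flip b) (Coalgebra.comul (R := R) h₁ * t)) := by
    intro t
    induction t with
    | zero => simp
    | tmul x y =>
      rw [← inner, ← h]
      simp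
    | add x y hx hy => simp only [mul_add, map_add, hx, hy]
  rw [Bialgebra.comul_mul, ← outer, ← h', map_mul act, Module.End.mul_apply]

end ModuleAlgebraStructure

/-! ### The algebra `U_q(sl₂)` and its module algebras -/

namespace Uqsl2

variable {q : ℂˣ}

@[elab_as_elim]
theorem induction {P : Uqsl2 q → Prop} (algebraMap : ∀ r : ℂ, P (algebraMap ℂ _ r))
    (k : P (k q)) (kinv : P (kinv q)) (e : P (e q)) (f : P (f q))
    (mul : ∀ a b, P a → P b → P (a * b)) (add : ∀ a b, P a → P b → P (a + b))
    (a : Uqsl2 q) : P a := by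
  obtain ⟨a, rfl⟩ := RingQuot.mkAlgHom_surjective ℂ (Rel q) a
  change P (mk q a)
  induction a using FreeAlgebra.induction with
  | grade0 r => rw [AlgHom.commutes]; exact algebraMap r
  | grade1 s => cases s <;> assumption
  | mul a b ha hb => rw [map_mul]; exact mul _ _ ha hb
  | add a b ha hb => rw [map_add]; exact add _ _ ha hb

theorem comul_k : Coalgebra.comul (R := ℂ) (k q) = k q ⊗ₜ k q := lift_k
theorem comul_kinv : Coalgebra.comul (R := ℂ) (kinv q) = kinv q ⊗ₜ kinv q := lift_kinv
theorem comul_e : Coalgebra.comul (R := ℂ) (e q) = 1 ⊗ₜ e q + e q ⊗ₜ k q := lift_e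
theorem comul_f : Coalgebra.comul (R := ℂ) (f q) = f q ⊗ₜ 1 + kinv q ⊗ₜ f q := lift_f
theorem counit_k : Coalgebra.counit (R := ℂ) (k q) = 1 := lift_k
theorem counit_kinv : Coalgebra.counit (R := ℂ) (kinv q) = 1 := lift_kinv
theorem counit_e : Coalgebra.counit (R := ℂ) (e q) = 0 := lift_e
theorem counit_f : Coalgebra.counit (R := ℂ) (f q) = 0 := lift_f

section ModuleAlgebra

variable {A : Type*} [Ring A] [Algebra ℂ A] (π : ModuleAlgebraStructure ℂ (Uqsl2 q) A)

theorem act_k_mul (a b : A) : π.act (k q) (a * b) = π.act (k q) a * π.act (k q) b := by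
  rw [π.act_mul, comul_k]; simp

theorem act_kinv_mul (a b : A) :
    π.act (kinv q) (a * b) = π.act (kinv q) a * π.act (kinv q) b := by
  rw [π.act_mul, comul_kinv]; simp

theorem act_e_mul (a b : A) :
    π.act (e q) (a * b) = a * π.act (e q) b + π.act (e q) a * π.act (k q) b := by
  rw [π.act_mul, comul_e]; simp

theorem act_f_mul (a b : A) :
    π.act (f q) (a * b) = π.act (kinv q) a * π.act (f q) b + π.act (f q) a * b := by
  rw [π.act_mul, comul_f]; simp [add_comm]

theorem act_k_one : π.act (k q) 1 = 1 := by rw [π.act_one, counit_k, map_one]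
theorem act_kinv_one : π.act (kinv q) 1 = 1 := by rw [π.act_one, counit_kinv, map_one]
theorem act_e_one : π.act (e q) 1 = 0 := by rw [π.act_one, counit_e, map_zero]
theorem act_f_one : π.act (f q) 1 = 0 := by rw [π.act_one, counit_f, map_zero]

/-- The action of `k`, as an algebra endomorphism. -/
noncomputable def actK : A →ₐ[ℂ] A :=
  AlgHom.ofLinearMap (π.act (k q)) (act_k_one π) (act_k_mul π)

/-- The action of `k⁻¹`, as an algebra endomorphism. -/
noncomputable def actKinv : A →ₐ[ℂ] A :=
  AlgHom.ofLinearMap (π.act (kinv q)) (act_kinv_one π) (act_kinv_mul π)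

/-- Operators satisfying the defining relations of `U_q(sl₂)`, the (skew) Leibniz rules and the
normalization at `1` give a module algebra structure. -/
theorem exists_moduleAlgebra (K K' E F : Module.End ℂ A)
    (h1 : K' * K = 1) (h2 : K * K' = 1)
    (h3 : K * E = (q : ℂ) ^ (2 : ℤ) • (E * K))
    (h4 : K * F = (q : ℂ) ^ (-2 : ℤ) • (F * K))
    (h5 : E * F - F * E = ((q : ℂ) - (q : ℂ)⁻¹)⁻¹ • (K - K'))
    (K_mul : ∀ a b, K (a * b) = K a * K b) (K'_mul : ∀ a b, K' (a * b) = K' a * K' b)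
    (E_mul : ∀ a b, E (a * b) = a * E b + E a * K b)
    (F_mul : ∀ a b, F (a * b) = F a * b + K' a * F b)
    (K_one : K 1 = 1) (K'_one : K' 1 = 1) (E_one : E 1 = 0) (F_one : F 1 = 0) :
    ∃ π : ModuleAlgebraStructure ℂ (Uqsl2 q) A,
      π.act (k q) = K ∧ π.act (e q) = E ∧ π.act (f q) = F := by
  refine ⟨⟨lift K K' E F h1 h2 h3 h4 h5, fun h => ?_, fun h => ?_⟩,
    lift_k (h1 := h1) (h2 := h2) (h3 := h3) (h4 := h4) (h5 := h5),
    lift_e (h1 := h1) (h2 := h2) (h3 := h3) (h4 := h4) (h5 := h5),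
    lift_f (h1 := h1) (h2 := h2) (h3 := h3) (h4 := h4) (h5 := h5)⟩
  · change ModuleAlgebraStructure.ActMulAt _ h
    induction h using Uqsl2.induction with
    | algebraMap r => exact .algebraMap _ r
    | k => intro a b; rw [comul_k]; simp [K_mul]
    | kinv => intro a b; rw [comul_kinv]; simp [K'_mul]
    | e => intro a b; rw [comul_e]; simp [E_mul]
    | f => intro a b; rw [comul_f]; simp [F_mul]
    | mul a b ha hb => exact ha.mul hb
    | add a b ha hb => exact ha.add hb
  · induction h using Uqsl2.induction with
    | algebraMap r => simp [Algebra.algebraMap_eq_smul_one]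
    | k => rw [counit_k]; simp [K_one]
    | kinv => rw [counit_kinv]; simp [K'_one]
    | e => rw [counit_e]; simp [E_one]
    | f => rw [counit_f]; simp [F_one]
    | mul a b ha hb =>
      rw [map_mul, Module.End.mul_apply, hb, Algebra.algebraMap_eq_smul_one, map_smul, ha,
        Bialgebra.counit_mul, mul_comm, map_mul, Algebra.smul_def]
    | add a b ha hb => rw [map_add, LinearMap.add_apply, ha, hb, map_add, map_add]

end ModuleAlgebra

end Uqsl2

/-! ### The quantum torus -/

namespace QLaurent

noncomputable section

variable {q : ℂˣ}

@[elab_as_elim]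
theorem induction {P : QLaurent q → Prop} (algebraMap : ∀ r : ℂ, P (algebraMap ℂ _ r))
    (x : P (x q)) (xinv : P ↑(QLaurent.x q)⁻¹) (y : P (y q)) (yinv : P ↑(QLaurent.y q)⁻¹)
    (mul : ∀ a b, P a → P b → P (a * b)) (add : ∀ a b, P a → P b → P (a + b))
    (a : QLaurent q) : P a := by
  obtain ⟨a, rfl⟩ := RingQuot.mkAlgHom_surjective ℂ (Rel q) a
  change P (mk q a)
  induction a using FreeAlgebra.induction with
  | grade0 r => rw [AlgHom.commutes]; exact algebraMap r
  | grade1 s => cases s <;> assumption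
  | mul a b ha hb => rw [map_mul]; exact mul _ _ ha hb
  | add a b ha hb => rw [map_add]; exact add _ _ ha hb

theorem y_mul_x : (y q : QLaurent q) * x q = (q : ℂ) • ((x q : QLaurent q) * y q) := by
  have := mk_rel q Rel.y_x
  rwa [map_mul, map_smul, map_mul] at this

/-- The universal property of the quantum torus. -/
def lift {B : Type*} [Ring B] [Algebra ℂ B] (X Y : Bˣ)
    (h : (Y : B) * X = (q : ℂ) • ((X : B) * Y)) : QLaurent q →ₐ[ℂ] B :=
  RingQuot.liftAlgHom ℂ ⟨FreeAlgebra.lift ℂ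
    (fun s => Gen.casesOn s (X : B) (Y : B) (↑X⁻¹ : B) (↑Y⁻¹ : B)), by
    rintro _ _ (_ | _ | _ | _ | _) <;> simp only [g, map_mul, map_smul, map_one,
      FreeAlgebra.lift_ι_apply, h, Units.mul_inv, Units.inv_mul]⟩

theorem lift_x {B : Type*} [Ring B] [Algebra ℂ B] {X Y : Bˣ}
    {h : (Y : B) * X = (q : ℂ) • ((X : B) * Y)} : lift X Y h (x q) = X :=
  (RingQuot.liftAlgHom_mkAlgHom_apply _ _ _ _).trans (FreeAlgebra.lift_ι_apply _ _)

theorem lift_y {B : Type*} [Ring B] [Algebra ℂ B] {X Y : Bˣ}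
    {h : (Y : B) * X = (q : ℂ) • ((X : B) * Y)} : lift X Y h (y q) = Y :=
  (RingQuot.liftAlgHom_mkAlgHom_apply _ _ _ _).trans (FreeAlgebra.lift_ι_apply _ _)

/-- Two linear maps satisfying the same skew Leibniz rule agree if they agree on `x` and `y`. -/
theorem skewDerivation_ext {B : Type*} [Ring B] [Algebra ℂ B] (σ τ : QLaurent q →ₐ[ℂ] B)
    {D D' : QLaurent q →ₗ[ℂ] B}
    (hD : ∀ a b, D (a * b) = σ a * D b + D a * τ b)
    (hD' : ∀ a b, D' (a * b) = σ a * D' b + D' a * τ b)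
    (one : D 1 = 0) (one' : D' 1 = 0)
    (hx : D (x q) = D' (x q)) (hy : D (y q) = D' (y q)) : D = D' := by
  have inv : ∀ z : (QLaurent q)ˣ, D z = D' z → D ↑z⁻¹ = D' ↑z⁻¹ := by
    intro z hz
    -- The Leibniz rule for `z z⁻¹ = 1` expresses `σ z * D z⁻¹` through `D z`, and `σ z` can be
    -- cancelled because it is a unit.
    have h := hD z ↑z⁻¹
    have h' := hD' z ↑z⁻¹
    rw [Units.mul_inv, one] at h
    rw [Units.mul_inv, one', ← hz] at h'
    have := add_right_cancel (h.symm.trans h')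
    have hu : IsUnit (σ z) := z.isUnit.map σ
    exact hu.mul_left_cancel this
  ext a
  induction a using QLaurent.induction with
  | algebraMap r => simp [Algebra.algebraMap_eq_smul_one, one, one']
  | x => exact hx
  | y => exact hy
  | xinv => exact inv _ hx
  | yinv => exact inv _ hy
  | mul a b ha hb => rw [hD, hD', ha, hb]
  | add a b ha hb => rw [map_add, map_add, ha, hb]

theorem algHom_ext {B : Type*} [Ring B] [Algebra ℂ B] {φ ψ : QLaurent q →ₐ[ℂ] B}
    (hx : φ (x q) = ψ (x q)) (hy : φ (y q) = ψ (y q)) : φ = ψ := by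
  have inv : ∀ z : (QLaurent q)ˣ, φ z = ψ z → φ ↑z⁻¹ = ψ ↑z⁻¹ := by
    intro z hz
    refine (z.isUnit.map φ).mul_left_cancel ?_
    rw [← map_mul, hz, ← map_mul, Units.mul_inv, map_one, map_one]
  ext a
  induction a using QLaurent.induction with
  | algebraMap r => simp
  | x => exact hx
  | y => exact hy
  | xinv => exact inv _ hx
  | yinv => exact inv _ hy
  | mul a b ha hb => rw [map_mul, map_mul, ha, hb]
  | add a b ha hb => rw [map_add, map_add, ha, hb]

/-! #### Monomials -/

/-- A scalar unit, as a unit of the quantum torus. -/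
def scalar (q : ℂˣ) : ℂˣ →* (QLaurent q)ˣ := Units.map (algebraMap ℂ (QLaurent q)).toMonoidHom

theorem scalar_mul (r : ℂˣ) (z : (QLaurent q)ˣ) :
    ((scalar q r * z : (QLaurent q)ˣ) : QLaurent q) = (r : ℂ) • (z : QLaurent q) := by
  rw [Units.val_mul, Algebra.smul_def]; rfl

theorem scalar_commute (r : ℂˣ) (z : (QLaurent q)ˣ) : Commute (scalar q r) z :=
  Units.ext (Algebra.commutes (r : ℂ) (z : QLaurent q))

/-- The relation `yx = qxy` is a semiconjugation in the unit group, so it passes to integer powers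
of either sign: first to powers of `x`, then, after exchanging the roles, to powers of `y`. -/
theorem y_zpow_mul_x_zpow (i j : ℤ) :
    y q ^ j * x q ^ i = scalar q (q ^ (j * i)) * (x q ^ i * y q ^ j) := by
  have h : SemiconjBy (y q) (x q) (scalar q q * x q) := by
    apply Units.ext
    rw [mul_assoc, scalar_mul]
    exact y_mul_x
  have h1 := h.zpow_right i
  rw [(scalar_commute q (x q)).mul_zpow, ← map_zpow] at h1
  have h2 : SemiconjBy (x q ^ i)⁻¹ (y q) (scalar q (q ^ i) * y q) := by
    have h3 : y q * x q ^ i = scalar q (q ^ i) * x q ^ i * y q := h1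
    have h4 := (scalar_commute (q ^ i) (x q ^ i)).eq
    rw [SemiconjBy, inv_mul_eq_iff_eq_mul, ← mul_assoc, ← mul_assoc, ← h4, ← h3, mul_assoc,
      mul_inv_cancel, mul_one]
  have h5 := h2.zpow_right j
  rw [(scalar_commute (q ^ i) (y q)).mul_zpow, ← map_zpow, ← zpow_mul, mul_comm i j] at h5
  have h6 : (x q ^ i)⁻¹ * y q ^ j = scalar q (q ^ (j * i)) * y q ^ j * (x q ^ i)⁻¹ := h5
  rw [inv_mul_eq_iff_eq_mul, ← mul_assoc, eq_mul_inv_iff_mul_eq, ← mul_assoc,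
    ← (scalar_commute (q ^ (j * i)) (x q ^ i)).eq] at h6
  rw [h6, mul_assoc]

theorem mon_mul_mon (i j k l : ℤ) :
    mon q i j * mon q k l = (q : ℂ) ^ (j * k) • mon q (i + k) (j + l) := by
  have h : x q ^ i * y q ^ j * (x q ^ k * y q ^ l) =
      scalar q (q ^ (j * k)) * (x q ^ (i + k) * y q ^ (j + l)) := by
    rw [mul_assoc, ← mul_assoc (y q ^ j), y_zpow_mul_x_zpow, mul_assoc, mul_assoc, ← zpow_add,
      ← mul_assoc, ← (scalar_commute _ _).eq, mul_assoc, ← mul_assoc (x q ^ i), ← zpow_add]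
  have h' := congrArg Units.val h
  rw [scalar_mul, Units.val_mul, Units.val_zpow_eq_zpow_val] at h'
  exact h'

theorem mon_zero_zero : mon q 0 0 = 1 := by simp [mon]
theorem mon_one_zero : mon q 1 0 = x q := by simp [mon]
theorem mon_zero_one : mon q 0 1 = y q := by simp [mon]

/-- Spanning suffices for the eigenvalue argument; linear independence of the monomials is not
needed. -/
theorem span_mon : Submodule.span ℂ (Set.range fun p : ℤ × ℤ => mon q p.1 p.2) = ⊤ := by
  rw [eq_top_iff]
  intro a _
  have hmon (i j : ℤ) :
      mon q i j ∈ Submodule.span ℂ (Set.range fun p : ℤ × ℤ => mon q p.1 p.2) :=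
    Submodule.subset_span ⟨(i, j), rfl⟩
  induction a using QLaurent.induction with
  | algebraMap r =>
    rw [Algebra.algebraMap_eq_smul_one, ← mon_zero_zero]
    exact Submodule.smul_mem _ _ (hmon _ _)
  | x => rw [← mon_one_zero]; exact hmon _ _
  | y => rw [← mon_zero_one]; exact hmon _ _
  | xinv => simpa [mon] using hmon (-1) 0
  | yinv => simpa [mon] using hmon 0 (-1)
  | mul a b ha hb =>
    have h := Submodule.mul_mem_mul (ha trivial) (hb trivial)
    rw [Submodule.span_mul_span] at h
    refine Submodule.span_le.mpr ?_ h
    rintro _ ⟨_, ⟨p, rfl⟩, _, ⟨r, rfl⟩, rfl⟩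
    change mon q p.1 p.2 * mon q r.1 r.2 ∈ _
    rw [mon_mul_mon]
    exact Submodule.smul_mem _ _ (hmon _ _)
  | add a b ha hb => exact Submodule.add_mem _ (ha trivial) (hb trivial)

theorem algHom_mon {φ : QLaurent q →ₐ[ℂ] QLaurent q} {α β : ℂˣ}
    (hx : φ (x q) = (α : ℂ) • (x q : QLaurent q)) (hy : φ (y q) = (β : ℂ) • (y q : QLaurent q))
    (i j : ℤ) : φ (mon q i j) = ((α ^ i * β ^ j : ℂˣ) : ℂ) • mon q i j := by
  have key : ∀ (z : (QLaurent q)ˣ) (r : ℂˣ) (n : ℤ), φ z = (r : ℂ) • (z : QLaurent q) →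
      Units.map φ.toMonoidHom (z ^ n) = scalar q (r ^ n) * z ^ n := by
    intro z r n hz
    have : Units.map φ.toMonoidHom z = scalar q r * z := by
      apply Units.ext
      rw [scalar_mul]
      exact hz
    rw [map_zpow, this, (scalar_commute r z).mul_zpow, map_zpow]
  have h : Units.map φ.toMonoidHom (x q ^ i * y q ^ j) =
      scalar q (α ^ i * β ^ j) * (x q ^ i * y q ^ j) := by
    rw [map_mul, key _ _ _ hx, key _ _ _ hy, map_mul, mul_assoc, ← mul_assoc (x q ^ i),
      ← (scalar_commute _ (x q ^ i)).eq]
    simp only [mul_assoc]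
  have h' := congrArg Units.val h
  rw [scalar_mul] at h'
  exact h'

/-- The quantum torus is non-trivial: it acts on functions on `ℤ` by shifts and by multiplication
by powers of `q`. -/
instance : Nontrivial (QLaurent q) := by
  let X : (Module.End ℂ (ℤ → ℂ))ˣ :=
    { val := LinearMap.funLeft ℂ ℂ (fun n : ℤ => n - 1)
      inv := LinearMap.funLeft ℂ ℂ (fun n : ℤ => n + 1)
      val_inv := by ext; simp [LinearMap.funLeft]
      inv_val := by ext; simp [LinearMap.funLeft] }
  let Y : (Module.End ℂ (ℤ → ℂ))ˣ :=
    { val := LinearMap.pi fun n : ℤ => (q : ℂ) ^ n • LinearMap.proj n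
      inv := LinearMap.pi fun n : ℤ => (q : ℂ) ^ (-n) • LinearMap.proj n
      val_inv := by ext v n; simp [zpow_ne_zero n q.ne_zero]
      inv_val := by ext v n; simp [zpow_ne_zero n q.ne_zero] }
  have h : (Y : Module.End ℂ (ℤ → ℂ)) * X = (q : ℂ) • ((X : Module.End ℂ (ℤ → ℂ)) * Y) := by
    refine LinearMap.ext fun v => funext fun n => ?_
    change (q : ℂ) ^ n * v (n - 1) = q * (q ^ (n - 1) * v (n - 1))
    rw [zpow_sub_one₀ q.ne_zero]
    field_simp
  exact (lift X Y h).toRingHom.domain_nontrivial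

/-! ### Diagonal automorphisms -/

/-- The automorphism `x ↦ α x`, `y ↦ β y`. -/
def scale (q α β : ℂˣ) : QLaurent q →ₐ[ℂ] QLaurent q :=
  lift (scalar q α * x q) (scalar q β * y q) (by
    simp only [scalar_mul, smul_mul_assoc, mul_smul_comm, y_mul_x, smul_smul]
    congr 1
    ring)

theorem scale_mon (α β : ℂˣ) (i j : ℤ) :
    scale q α β (mon q i j) = ((α ^ i * β ^ j : ℂˣ) : ℂ) • mon q i j :=
  algHom_mon (lift_x.trans (scalar_mul _ _)) (lift_y.trans (scalar_mul _ _)) i j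

theorem scale_scale (α β γ δ : ℂˣ) (h : α * γ = 1) (h' : β * δ = 1) (a : QLaurent q) :
    scale q α β (scale q γ δ a) = a := by
  have : (scale q α β).comp (scale q γ δ) = AlgHom.id ℂ _ := by
    apply algHom_ext
    · rw [← mon_one_zero, AlgHom.comp_apply, scale_mon, map_smul, scale_mon, smul_smul,
        ← Units.val_mul]
      simp [mul_comm γ, h]
    · rw [← mon_zero_one, AlgHom.comp_apply, scale_mon, map_smul, scale_mon, smul_smul,
        ← Units.val_mul]
      simp [mul_comm δ, h']
  exact DFunLike.congr_fun this a

end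

end QLaurent

/-! ### Symmetries of the quantum torus -/

namespace QSymmetry

open QLaurent

variable {q : ℂˣ}

/-- A symmetry is determined by the action of `k`, `e` and `f` on `x` and `y`. -/
theorem ext_of_generators {π π' : QSymmetry q}
    (kx : π.act (Uqsl2.k q) (x q : QLaurent q) = π'.act (Uqsl2.k q) (x q : QLaurent q))
    (ky : π.act (Uqsl2.k q) (y q : QLaurent q) = π'.act (Uqsl2.k q) (y q : QLaurent q))
    (ex : π.act (Uqsl2.e q) (x q : QLaurent q) = π'.act (Uqsl2.e q) (x q : QLaurent q))
    (ey : π.act (Uqsl2.e q) (y q : QLaurent q) = π'.act (Uqsl2.e q) (y q : QLaurent q))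
    (fx : π.act (Uqsl2.f q) (x q : QLaurent q) = π'.act (Uqsl2.f q) (x q : QLaurent q))
    (fy : π.act (Uqsl2.f q) (y q : QLaurent q) = π'.act (Uqsl2.f q) (y q : QLaurent q)) :
    π = π' := by
  have hk : π.act (Uqsl2.k q) = π'.act (Uqsl2.k q) :=
    congrArg AlgHom.toLinearMap (algHom_ext (φ := Uqsl2.actK π) (ψ := Uqsl2.actK π') kx ky)
  -- `k⁻¹` acts as the inverse of `k`, so its action is already determined.
  have hk' : π.act (Uqsl2.kinv q) = π'.act (Uqsl2.kinv q) := by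
    refine left_inv_eq_right_inv (a := π.act (Uqsl2.k q)) ?_ ?_
    · rw [← map_mul, Uqsl2.kinv_mul_k, map_one]
    · rw [hk, ← map_mul, Uqsl2.k_mul_kinv, map_one]
  have he : π.act (Uqsl2.e q) = π'.act (Uqsl2.e q) := by
    refine skewDerivation_ext (AlgHom.id ℂ _) (Uqsl2.actK π) (Uqsl2.act_e_mul π) ?_
      (Uqsl2.act_e_one π) (Uqsl2.act_e_one π') ex ey
    intro a b
    rw [Uqsl2.act_e_mul, ← hk]
    rfl
  have hf : π.act (Uqsl2.f q) = π'.act (Uqsl2.f q) := by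
    refine skewDerivation_ext (Uqsl2.actKinv π) (AlgHom.id ℂ _) (Uqsl2.act_f_mul π) ?_
      (Uqsl2.act_f_one π) (Uqsl2.act_f_one π') fx fy
    intro a b
    rw [Uqsl2.act_f_mul, ← hk']
    rfl
  exact ModuleAlgebraStructure.ext (Uqsl2.algHom_ext hk hk' he hf)

/-- For `m = x^u y^v` and `n = x^{-u} y^{-v}`, the automorphism `K` and the inner skew derivations
`b ↦ c (b m - m K(b))` and `b ↦ d (n b - K⁻¹(b) n)` define a symmetry. -/
theorem exists_inner (hq : (q : ℂ) ^ 2 ≠ 1) {α β : ℂˣ} {u v : ℤ}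
    (h : α ^ u * β ^ v = q ^ 2) {c d : ℂ}
    (hcd : c * d = (q : ℂ) ^ (u * v + 3) / (1 - (q : ℂ) ^ 2) ^ 2) :
    ∃ π : QSymmetry q, (∀ b, π.act (Uqsl2.k q) b = scale q α β b) ∧
      (∀ b, π.act (Uqsl2.e q) b = c • (b * mon q u v - mon q u v * scale q α β b)) ∧
      ∀ b, π.act (Uqsl2.f q) b =
        d • (mon q (-u) (-v) * b - scale q α⁻¹ β⁻¹ b * mon q (-u) (-v)) := by
  have KK' (b : QLaurent q) : scale q α β (scale q α⁻¹ β⁻¹ b) = b :=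
    scale_scale _ _ _ _ (mul_inv_cancel α) (mul_inv_cancel β) b
  have K'K (b : QLaurent q) : scale q α⁻¹ β⁻¹ (scale q α β b) = b :=
    scale_scale _ _ _ _ (inv_mul_cancel α) (inv_mul_cancel β) b
  have Km : scale q α β (mon q u v) = (q : ℂ) ^ (2 : ℤ) • mon q u v := by
    rw [scale_mon, h]; norm_cast
  have h' : α ^ (-u) * β ^ (-v) = (q ^ 2)⁻¹ := by rw [← h, zpow_neg, zpow_neg, mul_inv]
  have Kn : scale q α β (mon q (-u) (-v)) = (q : ℂ) ^ (-2 : ℤ) • mon q (-u) (-v) := by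
    rw [scale_mon, h', zpow_neg]; norm_cast
  have K'm : scale q α⁻¹ β⁻¹ (mon q u v) = (q : ℂ) ^ (-2 : ℤ) • mon q u v := by
    rw [scale_mon, inv_zpow', inv_zpow', h', zpow_neg]; norm_cast
  -- The factor comes from moving `y^v` past `x^{-u}`.
  have mn : mon q u v * mon q (-u) (-v) = (q : ℂ) ^ (-(u * v)) • (1 : QLaurent q) := by
    rw [mon_mul_mon, ← mon_zero_zero]; congr 2 <;> ring
  have nm : mon q (-u) (-v) * mon q u v = (q : ℂ) ^ (-(u * v)) • (1 : QLaurent q) := by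
    rw [mon_mul_mon, ← mon_zero_zero]; congr 2 <;> ring
  obtain ⟨π, hk, he, hf⟩ := Uqsl2.exists_moduleAlgebra (q := q) (scale q α β).toLinearMap (scale q α⁻¹ β⁻¹).toLinearMap
    (c • (LinearMap.mulRight ℂ (mon q u v) -
      LinearMap.mulLeft ℂ (mon q u v) * (scale q α β).toLinearMap))
    (d • (LinearMap.mulLeft ℂ (mon q (-u) (-v)) -
      LinearMap.mulRight ℂ (mon q (-u) (-v)) * (scale q α⁻¹ β⁻¹).toLinearMap))
    (by ext b; exact K'K b)
    (by ext b; exact KK' b)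
    (by
      ext b
      simp only [Module.End.mul_apply, LinearMap.smul_apply, LinearMap.sub_apply,
        LinearMap.mulRight_apply, LinearMap.mulLeft_apply, AlgHom.toLinearMap_apply, map_sub,
        map_mul, Km, smul_mul_assoc, mul_smul_comm]
      module)
    (by
      ext b
      simp only [Module.End.mul_apply, LinearMap.smul_apply, LinearMap.sub_apply,
        LinearMap.mulRight_apply, LinearMap.mulLeft_apply, AlgHom.toLinearMap_apply, map_sub,
        map_mul, Kn, smul_mul_assoc, mul_smul_comm, KK', K'K]
      module)
    (by
      ext b
      simp only [Module.End.mul_apply, LinearMap.smul_apply, LinearMap.sub_apply,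
        LinearMap.mulRight_apply, LinearMap.mulLeft_apply, AlgHom.toLinearMap_apply, map_smul,
        map_mul, Kn, K'm, smul_mul_assoc, mul_smul_comm, KK', K'K, mul_sub, sub_mul]
      have e1 (z : QLaurent q) : mon q u v * (mon q (-u) (-v) * z) = (q : ℂ) ^ (-(u * v)) • z := by
        rw [← mul_assoc, mn, smul_mul_assoc, one_mul]
      have e2 (z : QLaurent q) : mon q (-u) (-v) * (mon q u v * z) = (q : ℂ) ^ (-(u * v)) • z := by
        rw [← mul_assoc, nm, smul_mul_assoc, one_mul]
      have e3 (z : QLaurent q) : z * mon q u v * mon q (-u) (-v) = (q : ℂ) ^ (-(u * v)) • z := by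
        rw [mul_assoc, mn, mul_smul_comm, mul_one]
      have e4 (z : QLaurent q) : z * mon q (-u) (-v) * mon q u v = (q : ℂ) ^ (-(u * v)) • z := by
        rw [mul_assoc, nm, mul_smul_comm, mul_one]
      simp only [e1, e2, e3, e4, ← mul_assoc]
      -- After the cancellation of `n b m` and `m b n`, the left side is the coefficient of `K b -
      -- K⁻¹ b` in `EF - FE`. This equation dictates the value of `c d` in `hcd`.
      have hscal : c * d * ((q : ℂ) ^ (-(u * v)) * (1 - (q : ℂ) ^ (-2 : ℤ))) =
          ((q : ℂ) - (q : ℂ)⁻¹)⁻¹ := by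
        have hq0 : (q : ℂ) ≠ 0 := q.ne_zero
        have h1 : 1 - (q : ℂ) ^ 2 ≠ 0 := sub_ne_zero.mpr hq.symm
        have h2 : (q : ℂ) ^ 2 - 1 ≠ 0 := sub_ne_zero.mpr hq
        have h3 : (q : ℂ) - (q : ℂ)⁻¹ = ((q : ℂ) ^ 2 - 1) / q := by field_simp
        have h4 := zpow_ne_zero (u * v) hq0
        rw [hcd, h3, zpow_add₀ hq0, zpow_neg, zpow_neg]
        norm_cast at *
        push_cast at *
        field_simp
        ring
      rw [← hscal]
      module)
    (map_mul (scale q α β)) (map_mul (scale q α⁻¹ β⁻¹))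
    (by
      -- Telescoping: insert and remove `a m K(b)`.
      intro a b
      simp only [Module.End.mul_apply, LinearMap.smul_apply, LinearMap.sub_apply,
        LinearMap.mulRight_apply, LinearMap.mulLeft_apply, AlgHom.toLinearMap_apply, map_mul,
        smul_mul_assoc, mul_smul_comm, mul_sub, sub_mul, mul_assoc]
      module)
    (by
      intro a b
      simp only [Module.End.mul_apply, LinearMap.smul_apply, LinearMap.sub_apply,
        LinearMap.mulRight_apply, LinearMap.mulLeft_apply, AlgHom.toLinearMap_apply, map_mul,
        smul_mul_assoc, mul_smul_comm, mul_sub, sub_mul, mul_assoc]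
      module)
    (map_one (scale q α β)) (map_one (scale q α⁻¹ β⁻¹)) (by simp) (by simp)
  exact ⟨π, LinearMap.congr_fun hk, LinearMap.congr_fun he, LinearMap.congr_fun hf⟩

theorem existsUnique_hasGenericFormulas (hq : (q : ℂ) ^ 2 ≠ 1) {α β : ℂˣ} {u v : ℤ}
    (h : α ^ u * β ^ v = q ^ 2) (a : ℂˣ) :
    ∃! π : QSymmetry q, HasGenericFormulas q α β u v a π := by
  -- The formulas for `f` suggest `d = a⁻¹`, and the required product `c d` then gives `c`.
  have hcd : ((a : ℂ) * (q : ℂ) ^ (u * v + 3) / (1 - (q : ℂ) ^ 2) ^ 2) * (a : ℂ)⁻¹ =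
      (q : ℂ) ^ (u * v + 3) / (1 - (q : ℂ) ^ 2) ^ 2 := by
    have := a.ne_zero
    field_simp
  obtain ⟨π₀, hk, he, hf⟩ := exists_inner hq h hcd
  have hinner : HasGenericFormulas q α β u v a π₀ := by
    refine ⟨?_, ?_, ?_, ?_, ?_, ?_⟩
    · rw [hk, ← mon_one_zero, scale_mon]; simp
    · rw [hk, ← mon_zero_one, scale_mon]; simp
    · rw [he, ← mon_one_zero, scale_mon, mul_smul_comm, mon_mul_mon, mon_mul_mon]
      simp only [zero_mul, zpow_zero, one_smul, zpow_one, mul_one, add_zero, zero_add, smul_smul,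
        add_comm 1 u]
      module
    · rw [he, ← mon_zero_one, scale_mon, mul_smul_comm, mon_mul_mon, mon_mul_mon]
      simp only [zpow_zero, one_smul, zpow_one, one_mul, mul_zero, add_zero, zero_add,
        add_comm 1 v]
      module
    · rw [hf, ← mon_one_zero, scale_mon, smul_mul_assoc, mon_mul_mon, mon_mul_mon]
      simp only [zero_mul, zpow_zero, one_smul, zpow_one, mul_one, add_zero, zero_add,
        add_comm 1 (-u), Units.val_inv_eq_inv_val]
      module
    · rw [hf, ← mon_zero_one, scale_mon, smul_mul_assoc, mon_mul_mon, mon_mul_mon]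
      simp only [zpow_zero, one_smul, zpow_one, one_mul, mul_zero, add_zero, zero_add,
        smul_smul, add_comm 1 (-v), Units.val_inv_eq_inv_val]
      module
  refine ⟨_, hinner, fun π hπ => ext_of_generators ?_ ?_ ?_ ?_ ?_ ?_⟩
  · exact hπ.k_x.trans hinner.k_x.symm
  · exact hπ.k_y.trans hinner.k_y.symm
  · exact hπ.e_x.trans hinner.e_x.symm
  · exact hπ.e_y.trans hinner.e_y.symm
  · exact hπ.f_x.trans hinner.f_x.symm
  · exact hπ.f_y.trans hinner.f_y.symm

/-! ### Eigenvalues of `k` and orbits of symmetries -/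

/-- An eigenvalue of an operator which is diagonal on monomials is one of the diagonal entries. -/
theorem _root_.QLaurent.exists_eq_of_eigenvector {φ : Module.End ℂ (QLaurent q)} {χ : ℤ → ℤ → ℂ}
    (hφ : ∀ i j, φ (mon q i j) = χ i j • mon q i j) {μ : ℂ} {b : QLaurent q} (hb : b ≠ 0)
    (hμ : φ b = μ • b) : ∃ i j, χ i j = μ := by
  by_contra! hne
  -- If `μ` were not a diagonal entry, the other eigenspaces would contain every monomial and so
  -- fill the space; independence would then force the `μ`-eigenspace to vanish.
  have hdisj := φ.eigenspaces_iSupIndep μ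
  have htop : ⨆ ν, ⨆ (_ : ν ≠ μ), φ.eigenspace ν = ⊤ := by
    rw [eq_top_iff, ← span_mon, Submodule.span_le]
    rintro _ ⟨p, rfl⟩
    exact (le_iSup₂ (f := fun ν (_ : ν ≠ μ) => φ.eigenspace ν) (χ p.1 p.2) (hne p.1 p.2))
      (Module.End.mem_eigenspace_iff.mpr (hφ p.1 p.2))
  rw [htop, disjoint_top] at hdisj
  exact hb ((Submodule.mem_bot ℂ).mp (hdisj ▸ Module.End.mem_eigenspace_iff.mpr hμ))

theorem act_k_mon {π : QSymmetry q} {α β : ℂˣ} {u v : ℤ} {a : ℂˣ}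
    (h : HasGenericFormulas q α β u v a π) (i j : ℤ) :
    π.act (Uqsl2.k q) (mon q i j) = ((α ^ i * β ^ j : ℂˣ) : ℂ) • mon q i j :=
  algHom_mon (φ := Uqsl2.actK π) h.k_x h.k_y i j

/-- An automorphism may send `x` and `y` far from monomials, but no description of `Aut(A)` is
needed: the eigenvalues of `k` are a conjugation invariant. -/
theorem countable_weights {π : QSymmetry q} (hπ : IsGeneric q π) :
    {p : ℂˣ × ℂˣ | ∃ π' ∈ MulAction.orbit (QLaurent q ≃ₐ[ℂ] QLaurent q) π,
      IsGenericWithWeights q p.1 p.2 π'}.Countable := by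
  obtain ⟨α, β, -, u, v, a, -, hform⟩ := hπ
  refine (Set.countable_range fun r : (ℤ × ℤ) × (ℤ × ℤ) =>
    (α ^ r.1.1 * β ^ r.1.2, α ^ r.2.1 * β ^ r.2.2)).mono ?_
  rintro ⟨γ, δ⟩ ⟨_, ⟨Ψ, rfl⟩, -, u', v', a', -, hform'⟩
  have key : ∀ (z : (QLaurent q)ˣ) (ν : ℂˣ),
      (Ψ • π).act (Uqsl2.k q) (z : QLaurent q) = (ν : ℂ) • (z : QLaurent q) →
      ∃ i j : ℤ, α ^ i * β ^ j = ν := by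
    intro z ν hz
    have hz' : Ψ (π.act (Uqsl2.k q) (Ψ.symm z)) = (ν : ℂ) • (z : QLaurent q) := hz
    have hz'' := congrArg Ψ.symm hz'
    rw [Ψ.symm_apply_apply, map_smul] at hz''
    -- The pulled-back vector is an eigenvector of the original `k`; it is non-zero because `z` is a
    -- unit in a nontrivial ring.
    obtain ⟨i, j, hij⟩ := exists_eq_of_eigenvector (act_k_mon hform)
      ((map_ne_zero_iff _ Ψ.symm.injective).mpr z.ne_zero) hz''
    exact ⟨i, j, Units.ext hij⟩
  obtain ⟨i, j, hij⟩ := key _ _ hform'.k_x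
  obtain ⟨k, l, hkl⟩ := key _ _ hform'.k_y
  exact ⟨((i, j), (k, l)), Prod.ext hij hkl⟩

end QSymmetry

/-! ### Admissible pairs -/

theorem Complex.finite_units_zpow_eq {n : ℤ} (hn : n ≠ 0) (c : ℂˣ) :
    {z : ℂˣ | z ^ n = c}.Finite := by
  have hnat : ∀ (m : ℕ), 0 < m → ∀ c : ℂˣ, {z : ℂˣ | z ^ m = c}.Finite := by
    intro m hm c
    refine Set.Finite.of_finite_image (f := Units.val) ?_ Units.val_injective.injOn
    refine (Polynomial.nthRoots m (c : ℂ)).toFinset.finite_toSet.subset ?_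
    rintro _ ⟨z, hz, rfl⟩
    have hz' : z ^ m = c := hz
    simp [Polynomial.mem_nthRoots hm, ← hz']
  obtain ⟨m, rfl | rfl⟩ := n.eq_nat_or_neg
  · simpa using hnat m (by omega) c
  · simpa [inv_eq_iff_eq_inv] using hnat m (by omega) c⁻¹

theorem Complex.not_countable_univ_units : ¬ (Set.univ : Set ℂˣ).Countable := by
  intro h
  refine not_countable_complex (((h.image Units.val).union (Set.countable_singleton 0)).mono ?_)
  intro z _
  by_cases hz : z = 0
  · exact Or.inr hz
  · exact Or.inl ⟨Units.mk0 z hz, trivial, rfl⟩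

/-- The slice `α = q²`, with `(u, v) = (1, 0)`, is already uncountable. A bad `β` satisfies `β^n =
q^{2m}`: for each `n ≠ 0` and `m` this has finitely many solutions, and for `n = 0` it would make
`q` a root of unity. -/
theorem not_countable_isAdmissible {q : ℂˣ} (hq : ∀ n : ℤ, n ≠ 0 → q ^ n ≠ 1) :
    ¬ {p : ℂˣ × ℂˣ | IsAdmissible q p.1 p.2}.Countable := by
  intro hc
  have hbad : (⋃ (p : ℤ × ℤ) (_ : p.2 ≠ 0), {z : ℂˣ | z ^ p.2 = (q ^ 2) ^ p.1}).Countable :=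
    Set.countable_iUnion fun p => Set.countable_iUnion fun hp =>
      (Complex.finite_units_zpow_eq hp _).countable
  refine Complex.not_countable_univ_units (((hc.image Prod.snd).union hbad).mono ?_)
  intro z _
  by_cases hz : z ∈ ⋃ (p : ℤ × ℤ) (_ : p.2 ≠ 0), {z : ℂˣ | z ^ p.2 = (q ^ 2) ^ p.1}
  · exact Or.inr hz
  refine Or.inl ⟨(q ^ 2, z), ⟨⟨1, 0, by simp⟩, fun m n hmn h => ?_⟩, rfl⟩
  by_cases hn : n = 0
  · subst hn
    have hm : m ≠ 0 := fun hm => hmn (by rw [hm])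
    refine hq (2 * m) (by omega) ?_
    rw [zpow_mul]
    simpa using h
  · exact hz (Set.mem_iUnion₂.mpr ⟨(m, n), hn, h.symm⟩)

/-! ### The main theorem -/

theorem mainTheorem9 (q : ℂˣ) (hq : ∀ n : ℤ, n ≠ 0 → q ^ n ≠ 1) :
    -- the family: every admissible pair and every `a` give exactly one generic symmetry
    (∀ α β : ℂˣ, IsAdmissible q α β → ∀ u v : ℤ, α ^ u * β ^ v = q ^ 2 → ∀ a : ℂˣ,
      ∃! π : QSymmetry q, HasGenericFormulas q α β u v a π) ∧
    -- there are uncountably many admissible pairs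
    ¬ {p : ℂˣ × ℂˣ | IsAdmissible q p.1 p.2}.Countable ∧
    -- each orbit of the automorphism group meets only countably many admissible pairs
    (∀ π : QSymmetry q, IsGeneric q π →
      {p : ℂˣ × ℂˣ | ∃ π' ∈ MulAction.orbit (QLaurent q ≃ₐ[ℂ] QLaurent q) π,
        IsGenericWithWeights q p.1 p.2 π'}.Countable) ∧
    -- the generic symmetries fall into uncountably many isomorphism classes
    ¬ {c : ModuleAlgebraStructure.IsoClass ℂ (Uqsl2 q) (QLaurent q) |
        ∃ π : QSymmetry q, IsGeneric q π ∧ π.isoClass = c}.Countable := by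
  have hq2 : (q : ℂ) ^ 2 ≠ 1 := by
    intro h
    exact hq 2 two_ne_zero (Units.ext (by simpa using h))
  have hfamily : ∀ α β : ℂˣ, IsAdmissible q α β → ∀ u v : ℤ, α ^ u * β ^ v = q ^ 2 → ∀ a : ℂˣ,
      ∃! π : QSymmetry q, HasGenericFormulas q α β u v a π :=
    fun _ _ _ _ _ h a => QSymmetry.existsUnique_hasGenericFormulas hq2 h a
  refine ⟨hfamily, not_countable_isAdmissible hq, fun _ => QSymmetry.countable_weights, ?_⟩
  intro hc
  -- To each class attach the weight pairs of its generic members: each such set is countable by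
  -- `countable_weights`, and together they exhaust the admissible pairs.
  refine not_countable_isAdmissible hq ((hc.biUnion (t := fun c _ => {p : ℂˣ × ℂˣ |
    ∃ π' : QSymmetry q, π'.isoClass = c ∧ IsGenericWithWeights q p.1 p.2 π'}) ?_).mono ?_)
  · rintro _ ⟨π, hπ, rfl⟩
    refine (QSymmetry.countable_weights hπ).mono ?_
    rintro p ⟨π', hcl, hgen⟩
    obtain ⟨Ψ, hΨ⟩ : π.Isomorphic π' := Quotient.exact hcl.symm
    refine ⟨π', ⟨Ψ, ?_⟩, hgen⟩
    refine ModuleAlgebraStructure.ext (AlgHom.ext fun h => LinearMap.ext fun b => ?_)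
    exact hΨ h b
  · rintro ⟨α, β⟩ hp
    obtain ⟨u, v, huv⟩ := hp.1
    -- Any value of the parameter `a` would do; `1` is chosen.
    obtain ⟨π, hπ, -⟩ := hfamily α β hp u v huv 1
    have hgen : IsGenericWithWeights q α β π := ⟨hp, u, v, 1, huv, hπ⟩
    exact Set.mem_biUnion (x := π.isoClass) ⟨π, ⟨α, β, hgen⟩, rfl⟩ ⟨π, rfl, hgen⟩
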